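/- \textbf{Definitions.} A \emph{temporal structure} is a structure with domain $\mathbb{Q}$ all of whose relations are first-order definable (without parameters) in $(\mathbb{Q};<)$. For a structure $\mathfrak{B}$ with finite relational signature, $\mathrm{CSP}(\mathfrak{B})$ is the class of all finite structures of the same signature that map homomorphically to $\mathfrak{B}$; it is \emph{expressible in Datalog} if some sentence of Datalog, i.e. of the existential positive fragment of least fixed-point logic, defines, among the finite structures of that signature, exactly those that do not map homomorphically to $\mathfrak{B}$. A \emph{clone} on a set $A$ is a set of finitary operations on $A$ of arity at least one that contains all projections and is closed under composition; $\mathrm{Pol}(\mathfrak{B})$ is the clone of all polymorphisms of $\mathfrak{B}$. A \emph{clone homomorphism} is a map $\xi\colon\mathscr{A}\to\mathscr{B}$ between clones on $A$ and $B$ that preserves arities, projections and compositions; it is \emph{uniformly continuous} if for every finite $B'\subseteq B$ there is a finite $A'\subseteq A$ such that whenever $f,g\in\mathscr{A}$ of the same arity agree on $A'$ (on all tuples with entries in $A'$), $\xi(f)$ and $\xi(g)$ agree on $B'$. A \emph{condition} is a property of clones; it is \emph{preserved by uniformly continuous clone homomorphisms} if, whenever a clone $\mathscr{A}$ satisfies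 it and there is a uniformly continuous clone homomorphism $\mathscr{A}\to\mathscr{B}$, the clone $\mathscr{B}$ satisfies it. Let $$\mathrm{S}_{\mathrm{ll}}=\{(x,y,u,v)\in\mathbb{Q}^4 \mid x\neq y \text{ or } u\le v\},\qquad \mathrm{R}_{\min}=\{(x,y,z)\in\mathbb{Q}^3\mid y<x \text{ or } z<x\}.$$ \textbf{Theorem.} There is no condition $\mathcal{E}$ preserved by uniformly continuous clone homomorphisms that captures the expressibility of temporal CSPs in Datalog, i.e. such that for every temporal structure $\mathfrak{B}$ with finite relational signature, $\mathrm{CSP}(\mathfrak{B})$ is expressible in Datalog if and only if $\mathrm{Pol}(\mathfrak{B})$ satisfies $\mathcal{E}$. This is witnessed by two structures: $(\mathbb{Q};\neq,\mathrm{S}_{\mathrm{ll}})$ and $(\mathbb{Q};\mathrm{R}_{\min})$ are temporal structures, $\mathrm{CSP}(\mathbb{Q};\neq,\mathrm{S}_{\mathrm{ll}})$ is expressible in Datalog, $\mathrm{CSP}(\mathbb{Q};\mathrm{R}_{\min})$ is not expressible in Datalog, and there exists a uniformly continuous clone homomorphism from $\mathrm{Pol}(\mathbb{Q};\neq,\mathrm{S}_{\mathrm{ll}})$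 to $\mathrm{Pol}(\mathbb{Q};\mathrm{R}_{\min})$. -/

import Mathlib

open scoped FirstOrder

namespace TemporalCSP

/-! ### Datalog: the existential positive fragment of least fixed-point logic -/

/-- `RelVar Γ k` is the type of `k`-ary relation variables of a context `Γ`, which lists the
arities of the relation variables in scope (the most recently bound one comes first). -/
inductive RelVar : List ℕ → ℕ → Type
  | zero {k : ℕ} {Γ : List ℕ} : RelVar (k :: Γ) k
  | succ {k l : ℕ} {Γ : List ℕ} : RelVar Γ k → RelVar (l :: Γ) k

/-- An assignment of relations over `A` to the relation variables of a context. -/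
def RelEnv (Γ : List ℕ) (A : Type) : Type :=
  ∀ k : ℕ, RelVar Γ k → Set (Fin k → A)

/-- The empty assignment. -/
def RelEnv.nil {A : Type} : RelEnv [] A :=
  fun _ X => nomatch X

/-- Extend an assignment by a value for a newly bound relation variable. -/
def RelEnv.cons {Γ : List ℕ} {A : Type} {l : ℕ} (S : Set (Fin l → A)) (ρ : RelEnv Γ A) :
    RelEnv (l :: Γ) A
  | _, .zero => S
  | _, .succ X => ρ _ X

/-- Existential positive formulas with least fixed points over the relation symbols of `L`,
with relation variables from `Γ` and free first-order variables indexed by `Fin n`.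
`ex φ` quantifies the last variable of `φ`; `lfp φ t` is `[lfp_{X, x} φ(y, x)](t)`, where
the `k`-ary relation variable `X` and the last `k` variables `x` of `φ` are bound, and the
first `n` variables `y` of `φ` remain free as parameters. -/
inductive DatalogFormula (L : FirstOrder.Language.{0, 0}) : List ℕ → ℕ → Type
  | falsum {Γ : List ℕ} {n : ℕ} : DatalogFormula L Γ n
  | eq {Γ : List ℕ} {n : ℕ} (i j : Fin n) : DatalogFormula L Γ n
  | rel {Γ : List ℕ} {n k : ℕ} (R : L.Relations k) (t : Fin k → Fin n) : DatalogFormula L Γ n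
  | var {Γ : List ℕ} {n k : ℕ} (X : RelVar Γ k) (t : Fin k → Fin n) : DatalogFormula L Γ n
  | and {Γ : List ℕ} {n : ℕ} (φ ψ : DatalogFormula L Γ n) : DatalogFormula L Γ n
  | or {Γ : List ℕ} {n : ℕ} (φ ψ : DatalogFormula L Γ n) : DatalogFormula L Γ n
  | ex {Γ : List ℕ} {n : ℕ} (φ : DatalogFormula L Γ (n + 1)) : DatalogFormula L Γ n
  | lfp {Γ : List ℕ} {n k : ℕ} (φ : DatalogFormula L (k :: Γ) (n + k)) (t : Fin k → Fin n) :
      DatalogFormula L Γ n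

/-- Satisfaction. All formulas are positive, so the operator
`S ↦ {x | φ(y, x) holds with X := S}` is monotone, and its least fixed point is the
intersection of all `S` with `F S ⊆ S` (Knaster-Tarski). -/
def DatalogFormula.Realize {L : FirstOrder.Language.{0, 0}} {A : Type} [L.Structure A] :
    {Γ : List ℕ} → {n : ℕ} → DatalogFormula L Γ n → RelEnv Γ A → (Fin n → A) → Prop
  | _, _, .falsum, _, _ => False
  | _, _, .eq i j, _, v => v i = v j
  | _, _, .rel R t, _, v => FirstOrder.Language.Structure.RelMap R (fun i => v (t i))
  | _, _, .var X t, ρ, v => (fun i => v (t i)) ∈ ρ _ X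
  | _, _, .and φ ψ, ρ, v => φ.Realize ρ v ∧ ψ.Realize ρ v
  | _, _, .or φ ψ, ρ, v => φ.Realize ρ v ∨ ψ.Realize ρ v
  | _, _, .ex φ, ρ, v => ∃ a : A, φ.Realize ρ (Fin.snoc v a)
  | _, _, .lfp (k := k) φ t, ρ, v =>
      (fun i => v (t i)) ∈
        sInf {S : Set (Fin k → A) | {x | φ.Realize (ρ.cons S) (Fin.append v x)} ⊆ S}

/-- Datalog sentences: no free relation variables and no free first-order variables. -/
abbrev DatalogSentence (L : FirstOrder.Language.{0, 0}) : Type :=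
  DatalogFormula L [] 0

/-- `A ⊨ φ` for a Datalog sentence `φ`. -/
def DatalogSentence.Holds {L : FirstOrder.Language.{0, 0}} (φ : DatalogSentence L) (A : Type)
    [L.Structure A] : Prop :=
  DatalogFormula.Realize φ (RelEnv.nil : RelEnv [] A) Fin.elim0

/-- `CSP(B)` is expressible in Datalog: some Datalog sentence defines the class of all finite
structures that do not map homomorphically to `B`. -/
def CSPExpressibleInDatalog (L : FirstOrder.Language.{0, 0}) (B : Type) [L.Structure B] : Prop :=
  ∃ φ : DatalogSentence L, ∀ (A : Type) [Finite A] [L.Structure A],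
    φ.Holds A ↔ ¬ Nonempty (A →[L] B)

/-! ### Clones, clone homomorphisms, uniform continuity -/

/-- A clone over `A`: a set of operations of arity at least one that contains all projections
and is closed under composition; `ops n` is the set of its `n`-ary members. -/
structure OpClone (A : Type) where
  ops : (n : ℕ) → Set ((Fin n → A) → A)
  arity_pos : ∀ {n : ℕ} {f : (Fin n → A) → A}, f ∈ ops n → 0 < n
  proj_mem : ∀ {n : ℕ} (i : Fin n), (fun x : Fin n → A => x i) ∈ ops n
  comp_mem : ∀ {n m : ℕ} {f : (Fin n → A) → A} {g : Fin n → (Fin m → A) → A},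
    f ∈ ops n → (∀ i, g i ∈ ops m) → (fun x : Fin m → A => f (fun i => g i x)) ∈ ops m

/-- The `i`-th `n`-ary projection as a member of a clone. -/
def OpClone.proj {A : Type} (C : OpClone A) {n : ℕ} (i : Fin n) : C.ops n :=
  ⟨fun x => x i, C.proj_mem i⟩

/-- The composition `f(g₁, …, gₙ)` in a clone. -/
def OpClone.comp {A : Type} (C : OpClone A) {n m : ℕ} (f : C.ops n) (g : Fin n → C.ops m) :
    C.ops m :=
  ⟨fun x => f.1 (fun i => (g i).1 x), C.comp_mem f.2 (fun i => (g i).2)⟩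

/-- Clone homomorphisms: arity preserving maps that preserve projections and compositions. -/
structure CloneHom {A B : Type} (C : OpClone A) (D : OpClone B) where
  toFun : {n : ℕ} → C.ops n → D.ops n
  map_proj : ∀ {n : ℕ} (i : Fin n), toFun (C.proj i) = D.proj i
  map_comp : ∀ {n m : ℕ} (f : C.ops n) (g : Fin n → C.ops m),
    toFun (C.comp f g) = D.comp (toFun f) (fun i => toFun (g i))

/-- Uniform continuity of a clone homomorphism; operations agree on a set `S` if they agree on
all tuples with entries in `S`. -/
def CloneHom.UniformlyContinuous {A B : Type} {C : OpClone A} {D : OpClone B}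
    (ξ : CloneHom C D) : Prop :=
  ∀ B' : Set B, B'.Finite → ∃ A' : Set A, A'.Finite ∧
    ∀ (n : ℕ) (f g : C.ops n), (∀ x : Fin n → A, (∀ i, x i ∈ A') → f.1 x = g.1 x) →
      ∀ y : Fin n → B, (∀ i, y i ∈ B') → (ξ.toFun f).1 y = (ξ.toFun g).1 y

/-- `f` is a polymorphism of the `L`-structure `A`: applied coordinatewise to tuples
`t 0, …, t (n - 1)` of a relation, it yields a tuple of that relation. -/
def IsPolymorphism (L : FirstOrder.Language.{0, 0}) {A : Type} [L.Structure A] {n : ℕ}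
    (f : (Fin n → A) → A) : Prop :=
  ∀ (k : ℕ) (R : L.Relations k) (t : Fin n → Fin k → A),
    (∀ i, FirstOrder.Language.Structure.RelMap R (t i)) →
      FirstOrder.Language.Structure.RelMap R (fun j => f (fun i => t i j))

/-- The polymorphism clone of a structure. -/
def Pol (L : FirstOrder.Language.{0, 0}) (A : Type) [L.Structure A] : OpClone A where
  ops n := {f | 0 < n ∧ IsPolymorphism L f}
  arity_pos h := h.1
  proj_mem i := ⟨i.pos, fun _ _ _ ht => ht i⟩
  comp_mem {_ _ _ _} hf hg :=
    ⟨(hg ⟨0, hf.1⟩).1, fun k R t ht => hf.2 k R _ (fun i => (hg i).2 k R t ht)⟩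

/-- A condition on clones: a property that each clone, over any set, has or fails to have. -/
abbrev CloneCondition : Type 1 :=
  (A : Type) → OpClone A → Prop

/-- If `C` satisfies the condition and there is a uniformly continuous clone homomorphism from
`C` to `D`, then `D` satisfies the condition. -/
def PreservedByUCCloneHoms (E : CloneCondition) : Prop :=
  ∀ (A B : Type) (C : OpClone A) (D : OpClone B) (ξ : CloneHom C D),
    ξ.UniformlyContinuous → E A C → E B D

/-! ### Temporal structures -/

/-- The signature of `(ℚ; <)`. -/
inductive LtRel : ℕ → Type
  | lt : LtRel 2

/-- The signature of `(ℚ; <)` as a first-order language. -/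
def ltLang : FirstOrder.Language.{0, 0} := ⟨fun _ => Empty, LtRel⟩

/-- The structure `(ℚ; <)`. -/
instance ltStructure : ltLang.Structure ℚ where
  funMap f := nomatch f
  RelMap {_} R := match R with
    | LtRel.lt => fun v => v 0 < v 1

/-- A structure with domain `ℚ` is temporal if all its relations are first-order definable
(without parameters) in `(ℚ; <)`. -/
def IsTemporal (L : FirstOrder.Language.{0, 0}) [L.Structure ℚ] : Prop :=
  ∀ (k : ℕ) (R : L.Relations k),
    (∅ : Set ℚ).Definable ltLang {t : Fin k → ℚ | FirstOrder.Language.Structure.RelMap R t}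

/-- The condition `E` captures the expressibility of temporal CSPs in Datalog: for every
temporal structure with a finite relational signature, its CSP is expressible in Datalog if and
only if its polymorphism clone satisfies `E`. -/
def CapturesDatalogForTemporalCSPs (E : CloneCondition) : Prop :=
  ∀ (L : FirstOrder.Language.{0, 0}) [L.IsRelational] [Finite (Σ k, L.Relations k)] [L.Structure ℚ],
    IsTemporal L → (CSPExpressibleInDatalog L ℚ ↔ E ℚ (Pol L ℚ))

/-- The relation symbols of `(ℚ; ≠, S_ll)`. -/
inductive NeSllRel : ℕ → Type
  | ne : NeSllRel 2
  | sll : NeSllRel 4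

/-- The signature of `(ℚ; ≠, S_ll)`. -/
def neSllLang : FirstOrder.Language.{0, 0} := ⟨fun _ => Empty, NeSllRel⟩

/-- The structure `(ℚ; ≠, S_ll)` with
`S_ll = {(x, y, u, v) | x ≠ y ∨ u ≤ v}`. -/
instance neSllStructure : neSllLang.Structure ℚ where
  funMap f := nomatch f
  RelMap {_} R := match R with
    | NeSllRel.ne => fun v => v 0 ≠ v 1
    | NeSllRel.sll => fun v => v 0 ≠ v 1 ∨ v 2 ≤ v 3

/-- The relation symbols of `(ℚ; R_min)`. -/
inductive RminRel : ℕ → Type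
  | rmin : RminRel 3

/-- The signature of `(ℚ; R_min)`. -/
def rminLang : FirstOrder.Language.{0, 0} := ⟨fun _ => Empty, RminRel⟩

/-- The structure `(ℚ; R_min)` with `R_min = {(x, y, z) | y < x ∨ z < x}`. -/
instance rminStructure : rminLang.Structure ℚ where
  funMap f := nomatch f
  RelMap {_} R := match R with
    | RminRel.rmin => fun v => v 1 < v 0 ∨ v 2 < v 0

end TemporalCSP

/-!
A condition that is preserved by uniformly continuous clone homomorphisms and captures Datalog would
pass from the polymorphisms of `(ℚ; ≠, S_ll)`, whose CSP is solved by Datalog, to those of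
`(ℚ; R_min)`, whose CSP is not, because there is such a homomorphism between the two clones.

*Datalog for `(ℚ; ≠, S_ll)`.* The relation `S_ll` is the implication `x = y → u ≤ v`. The
inequalities forced by an instance form a preorder that Datalog computes, and the instance is
unsatisfiable if and only if two elements that have to be different are forced to be equal
(`nonempty_hom_of_forall_not_forced`).

*The clone homomorphism.* A polymorphism of `(ℚ; ≠, S_ll)` is injective as a function of its
essential arguments (`IsPolymorphism.apply_eq_iff`). Hence the essential arguments of a composition
`f(g₁, …, gₙ)` are those of the `gᵢ` for the essential arguments `i` of `f`, and mapping `f` to the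
minimum of its essential arguments is a clone homomorphism; the values are polymorphisms of
`R_min`, and they depend only on the values of `f` on tuples over `{0, 1}`.

*No Datalog for `(ℚ; R_min)`.* Truth of a Datalog sentence is preserved by strategies of Duplicator
in existential pebble games (`PebbleStrategy.realize`), and a sentence that is true in a structure
is true in a finite substructure (`DatalogFormula.Realize.exists_finite`). So it suffices to find,
for every `K`, a finite instance of `R_min` without a solution on which Duplicator survives with `K`
pebbles (`not_cspExpressibleInDatalog_of_strategies`). Such an instance is a large torus
`ℤ/N × ℤ/N`, in which every point is larger than the minimum of its right and its upper neighbour.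
It has no solution, but the constraints that follow from a set `U` of points only bound a point
of `U` by the minimum over the out-boundary of `U`. A set of fewer than `N` points has at most
as many elements as the square of the size of its out-boundary (`card_le_card_bdry_sq`), so that
constraints on few pebbled points stem from small sets, and these are consistent (`Good.extend`).
-/

namespace TemporalCSP

/-! ### The signatures -/

instance : rminLang.IsRelational := fun _ => inferInstanceAs (IsEmpty Empty)

instance : neSllLang.IsRelational := fun _ => inferInstanceAs (IsEmpty Empty)

instance : Finite (Σ k, neSllLang.Relations k) :=
  Finite.of_surjective (fun b : Bool => (bif b then ⟨2, NeSllRel.ne⟩ else ⟨4, NeSllRel.sll⟩ :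
    Σ k, NeSllRel k)) fun ⟨_, R⟩ => by
      cases R
      · exact ⟨true, rfl⟩
      · exact ⟨false, rfl⟩

instance : Finite (Σ k, rminLang.Relations k) :=
  Finite.of_surjective (fun _ : Unit => (⟨3, RminRel.rmin⟩ : Σ k, RminRel k)) fun ⟨_, R⟩ => by
    cases R
    exact ⟨(), rfl⟩

/-! ### Definability -/

theorem definable_setOf_lt {α : Type} (i j : α) :
    (∅ : Set ℚ).Definable ltLang {v : α → ℚ | v i < v j} := by
  rw [Set.empty_definable_iff]
  refine ⟨FirstOrder.Language.Relations.formula₂ (L := ltLang) LtRel.lt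
    (FirstOrder.Language.Term.var i) (FirstOrder.Language.Term.var j), ?_⟩
  ext v
  exact (FirstOrder.Language.Formula.realize_rel₂ (L := ltLang) (R := LtRel.lt)
    (t₁ := .var i) (t₂ := .var j) (v := v)).symm

theorem isTemporal_neSllLang : IsTemporal neSllLang := by
  intro k R
  cases R with
  | ne =>
    convert (definable_setOf_lt (0 : Fin 2) 1).union (definable_setOf_lt (1 : Fin 2) 0) using 1
    ext v
    exact ne_iff_lt_or_gt
  | sll =>
    convert ((definable_setOf_lt (0 : Fin 4) 1).union (definable_setOf_lt (1 : Fin 4) 0)).union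
      (definable_setOf_lt (3 : Fin 4) 2).compl using 1
    ext v
    exact or_congr ne_iff_lt_or_gt not_lt.symm

theorem isTemporal_rminLang : IsTemporal rminLang := by
  intro k R
  cases R with
  | rmin => exact (definable_setOf_lt (1 : Fin 3) 0).union (definable_setOf_lt (2 : Fin 3) 0)

/-! ### A clone homomorphism from `Pol (ℚ; ≠, S_ll)` to `Pol (ℚ; R_min)` -/

open Classical in
/-- The set of essential arguments of `f`, detected on the tuples with entries in `{0, 1}`: the
argument `i` is essential if changing it from `0` to `1` in the zero tuple changes the value.
For polymorphisms of `(ℚ; ≠, S_ll)` this agrees with the usual notion. -/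
noncomputable def essentialArgs {n : ℕ} (f : (Fin n → ℚ) → ℚ) : Finset (Fin n) :=
  Finset.univ.filter fun i => f (Pi.single i 1) ≠ f 0

theorem mem_essentialArgs {n : ℕ} {f : (Fin n → ℚ) → ℚ} {i : Fin n} :
    i ∈ essentialArgs f ↔ f (Pi.single i 1) ≠ f 0 := by
  simp [essentialArgs]

/-- If two tuples have the same value, then the arguments in which they differ are irrelevant:
this is preservation of `S_ll` read as the implication `x = y → u ≤ v`. -/
theorem IsPolymorphism.apply_eq_of_apply_eq {n : ℕ} {f : (Fin n → ℚ) → ℚ}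
    (hf : IsPolymorphism neSllLang f) {x y u v : Fin n → ℚ} (hxy : f x = f y)
    (h : ∀ i, x i = y i → u i = v i) : f u = f v := by
  have key : ∀ u v : Fin n → ℚ, (∀ i, x i = y i → u i = v i) → f u ≤ f v := by
    intro u v h
    have := hf 4 NeSllRel.sll (fun i => ![x i, y i, u i, v i]) fun i => by
      by_cases hi : x i = y i
      · exact Or.inr (h i hi).le
      · exact Or.inl hi
    exact this.resolve_left fun h' => h' hxy
  exact le_antisymm (key u v h) (key v u fun i hi => (h i hi).symm)

/-- A polymorphism of `(ℚ; ≠, S_ll)` is injective as a function of its essential arguments. -/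
theorem IsPolymorphism.apply_eq_iff {n : ℕ} {f : (Fin n → ℚ) → ℚ}
    (hf : IsPolymorphism neSllLang f) {x y : Fin n → ℚ} :
    f x = f y ↔ ∀ i ∈ essentialArgs f, x i = y i := by
  constructor
  · intro hxy i hi
    by_contra hne
    refine mem_essentialArgs.1 hi (hf.apply_eq_of_apply_eq hxy fun j hj => ?_)
    have hji : j ≠ i := by
      rintro rfl
      exact hne hj
    simp [hji]
  · have key : ∀ (T : Finset (Fin n)), Disjoint T (essentialArgs f) →
        ∀ x y : Fin n → ℚ, (∀ i, i ∉ T → x i = y i) → f x = f y := by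
      intro T
      induction T using Finset.induction_on with
      | empty =>
        intro _ x y h
        rw [funext fun i => h i (Finset.notMem_empty i)]
      | insert a T _ ih =>
        intro hT x y h
        rw [Finset.disjoint_insert_left, mem_essentialArgs, not_not] at hT
        have h1 : f x = f (Function.update x a (y a)) := by
          refine hf.apply_eq_of_apply_eq hT.1 fun i hi => ?_
          have hia : i ≠ a := by
            rintro rfl
            simp at hi
          simp [hia]
        rw [h1]
        refine ih hT.2 _ _ fun i hi => ?_
        by_cases hia : i = a
        · subst hia
          simp
        · simp [hia, h i (by simp [hia, hi])]
    intro h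
    exact key (essentialArgs f)ᶜ disjoint_compl_left x y fun i hi => h i (by simpa using hi)

theorem IsPolymorphism.essentialArgs_nonempty {n : ℕ} {f : (Fin n → ℚ) → ℚ}
    (hf : IsPolymorphism neSllLang f) : (essentialArgs f).Nonempty := by
  by_contra h
  rw [Finset.not_nonempty_iff_eq_empty] at h
  have hne : f (fun _ => 0) ≠ f (fun _ => 1) :=
    hf 2 NeSllRel.ne (fun _ => ![0, 1]) fun _ => zero_ne_one
  exact hne (hf.apply_eq_iff.2 (by simp [h]))

theorem isPolymorphism_inf' {n : ℕ} (E : Finset (Fin n)) (hE : E.Nonempty) :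
    IsPolymorphism rminLang fun y : Fin n → ℚ => E.inf' hE y := by
  intro k R t ht
  cases R with
  | rmin =>
    obtain ⟨i, hi, hmin⟩ := E.exists_mem_eq_inf' hE fun i => t i 0
    have hlt : ∀ j, t i j < t i 0 → E.inf' hE (fun i => t i j) < E.inf' hE fun i => t i 0 :=
      fun j hj => (Finset.inf'_le (fun i => t i j) hi).trans_lt (hj.trans_eq hmin.symm)
    exact (ht i).imp (hlt 1) (hlt 2)

theorem mem_essentialArgs_comp {n m : ℕ} (f : (Pol neSllLang ℚ).ops n)
    (g : Fin n → (Pol neSllLang ℚ).ops m) (j : Fin m) :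
    j ∈ essentialArgs ((Pol neSllLang ℚ).comp f g).1 ↔
      ∃ i ∈ essentialArgs f.1, j ∈ essentialArgs (g i).1 := by
  rw [mem_essentialArgs]
  change ¬(f.1 _ = f.1 _) ↔ _
  rw [IsPolymorphism.apply_eq_iff f.2.2]
  push Not
  simp only [mem_essentialArgs]

/-- The clone homomorphism that sends `f` to the minimum of its essential arguments. -/
noncomputable def minEssentialHom : CloneHom (Pol neSllLang ℚ) (Pol rminLang ℚ) where
  toFun f := ⟨fun y => (essentialArgs f.1).inf' (IsPolymorphism.essentialArgs_nonempty f.2.2) y,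
    f.2.1, isPolymorphism_inf' _ _⟩
  map_proj {n} i := by
    refine Subtype.ext (funext fun y => eq_of_forall_le_iff fun q => ?_)
    have : ∀ j, j ∈ essentialArgs ((Pol neSllLang ℚ).proj i).1 ↔ j = i := fun j => by
      rw [mem_essentialArgs]
      simp [OpClone.proj, Pi.single_apply, eq_comm]
    simp only [Finset.le_inf'_iff, this, forall_eq]
    rfl
  map_comp f g := by
    refine Subtype.ext (funext fun y => eq_of_forall_le_iff fun q => ?_)
    simp only [Finset.le_inf'_iff, mem_essentialArgs_comp]
    refine Iff.trans ?_ (Finset.le_inf'_iff (IsPolymorphism.essentialArgs_nonempty f.2.2) _).symm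
    simp only [Finset.le_inf'_iff]
    exact ⟨fun h i hi j hj => h j ⟨i, hi, hj⟩, fun h j ⟨i, hi, hj⟩ => h i hi j hj⟩

theorem minEssentialHom_uniformlyContinuous : minEssentialHom.UniformlyContinuous := by
  refine fun _ _ => ⟨{0, 1}, by simp, fun n f g hfg y _ => ?_⟩
  have h0 : f.1 0 = g.1 0 := hfg 0 fun i => by simp
  have h1 : ∀ i, f.1 (Pi.single i 1) = g.1 (Pi.single i 1) := fun i => hfg _ fun j => by
    by_cases hj : j = i <;> simp [hj]
  have hE : essentialArgs f.1 = essentialArgs g.1 := by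
    ext i
    rw [mem_essentialArgs, mem_essentialArgs, h0, h1]
  simp only [minEssentialHom, hE]

/-! ### A Datalog sentence for `(ℚ; ≠, S_ll)` -/

/-- The body of the least fixed point that defines the forced inequalities `x ≤ y` of an
instance: `x = y`, or `X x z` and `X z y` for some `z`, or `X a b`, `X b a` and `S_ll a b x y` for
some `a, b`. The variables `0` and `1` are parameters that it does not mention, `x` is the
variable `2` and `y` the variable `3`. -/
def forcedLeBody : DatalogFormula neSllLang [2] (2 + 2) :=
  .or (.eq 2 3) <| .or
    (.ex (.and (.var (n := 5) .zero ![2, 4]) (.var (n := 5) .zero ![4, 3])))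
    (.ex (.ex (.and (.and (.var (n := 6) .zero ![4, 5]) (.var (n := 6) .zero ![5, 4]))
      (.rel (n := 6) (k := 4) NeSllRel.sll ![4, 5, 2, 3]))))

/-- Some `a`, `b` with `a ≠ b` in the instance are forced to satisfy `a ≤ b` and `b ≤ a`. -/
def forcedEqSentence : DatalogSentence neSllLang :=
  .ex (.ex (.and (.and (.lfp (n := 2) forcedLeBody ![0, 1]) (.lfp (n := 2) forcedLeBody ![1, 0]))
    (.rel (n := 2) (k := 2) NeSllRel.ne ![0, 1])))

/-- The inequalities `x ≤ y` forced in an instance of `CSP(ℚ; ≠, S_ll)`. -/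
inductive ForcedLe {A : Type} [neSllLang.Structure A] : A → A → Prop
  | refl (x : A) : ForcedLe x x
  | trans {x y z : A} : ForcedLe x y → ForcedLe y z → ForcedLe x z
  | sll {a b x y : A} : ForcedLe a b → ForcedLe b a →
      FirstOrder.Language.Structure.RelMap (L := neSllLang) (n := 4) NeSllRel.sll ![a, b, x, y] →
      ForcedLe x y

section
variable {A : Type} [neSllLang.Structure A]

theorem comp_vec₂ {α β : Type} (w : α → β) (a b : α) :
    (fun i => w (![a, b] i)) = ![w a, w b] := by
  ext i
  fin_cases i <;> rfl

theorem comp_vec₄ {α β : Type} (w : α → β) (a b c d : α) :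
    (fun i => w (![a, b, c, d] i)) = ![w a, w b, w c, w d] := by
  ext i
  fin_cases i <;> rfl

theorem realize_forcedLeBody (ρ : RelEnv [] A) (S : Set (Fin 2 → A)) (v x : Fin 2 → A) :
    forcedLeBody.Realize (ρ.cons S) (Fin.append v x) ↔
      x 0 = x 1 ∨ (∃ z, ![x 0, z] ∈ S ∧ ![z, x 1] ∈ S) ∨
        ∃ a b, (![a, b] ∈ S ∧ ![b, a] ∈ S) ∧
          FirstOrder.Language.Structure.RelMap (L := neSllLang) (n := 4) NeSllRel.sll
            ![a, b, x 0, x 1] := by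
  simp only [forcedLeBody, DatalogFormula.Realize, RelEnv.cons, comp_vec₂, comp_vec₄]
  rfl

theorem realize_lfp_forcedLeBody (ρ : RelEnv [] A) (v : Fin 2 → A) (i j : Fin 2) :
    (DatalogFormula.lfp forcedLeBody ![i, j]).Realize ρ v ↔ ForcedLe (v i) (v j) := by
  simp only [DatalogFormula.Realize, comp_vec₂, realize_forcedLeBody]
  constructor
  · intro h
    refine h {x | ForcedLe (x 0) (x 1)} ?_
    rintro x (h | ⟨z, h₁, h₂⟩ | ⟨a, b, ⟨h₁, h₂⟩, h⟩)
    · change ForcedLe (x 0) (x 1)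
      exact h ▸ ForcedLe.refl _
    · exact ForcedLe.trans h₁ h₂
    · exact ForcedLe.sll h₁ h₂ h
  · intro h S hS
    generalize v i = x, v j = y at h
    induction h with
    | refl x => exact hS (Or.inl rfl)
    | trans _ _ ih₁ ih₂ => exact hS (Or.inr (Or.inl ⟨_, ih₁, ih₂⟩))
    | sll _ _ h ih₁ ih₂ => exact hS (Or.inr (Or.inr ⟨_, _, ⟨ih₁, ih₂⟩, h⟩))

theorem holds_forcedEqSentence_iff :
    DatalogSentence.Holds forcedEqSentence A ↔
      ∃ a b : A, (ForcedLe a b ∧ ForcedLe b a) ∧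
        FirstOrder.Language.Structure.RelMap (L := neSllLang) (n := 2) NeSllRel.ne ![a, b] := by
  change (∃ a b : A, ((DatalogFormula.lfp forcedLeBody ![0, 1]).Realize _ _ ∧
    (DatalogFormula.lfp forcedLeBody ![1, 0]).Realize _ _) ∧
    FirstOrder.Language.Structure.RelMap _ fun i => _) ↔ _
  simp only [realize_lfp_forcedLeBody, comp_vec₂]
  rfl

theorem ForcedLe.map_le (h : A →[neSllLang] ℚ) {x y : A} (hxy : ForcedLe x y) : h x ≤ h y := by
  induction hxy with
  | refl => exact le_rfl
  | trans _ _ ih₁ ih₂ => exact ih₁.trans ih₂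
  | sll _ _ hr ih₁ ih₂ =>
    have := h.map_rel _ _ hr
    exact this.resolve_left fun hne => hne (le_antisymm ih₁ ih₂)

/-- The preorder of the forced inequalities. -/
abbrev forcedPreorder (A : Type) [neSllLang.Structure A] : Preorder A where
  le := ForcedLe
  le_refl := ForcedLe.refl
  le_trans _ _ _ := ForcedLe.trans

/-- If no two elements that have to be different are forced to be equal, then the partial order
of the forced inequalities, extended to a linear order and embedded into `ℚ`, is a solution. -/
theorem nonempty_hom_of_forall_not_forced [Finite A]
    (hne : ∀ a b : A, ForcedLe a b → ForcedLe b a →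
      ¬ FirstOrder.Language.Structure.RelMap (L := neSllLang) (n := 2) NeSllRel.ne ![a, b]) :
    Nonempty (A →[neSllLang] ℚ) := by
  let _ := forcedPreorder A
  let Q := LinearExtension (Antisymmetrization A (· ≤ ·))
  have : Finite Q := inferInstanceAs (Finite (Quotient _))
  obtain ⟨e⟩ := Order.embedding_from_countable_to_dense Q ℚ
  let q : A → Antisymmetrization A (· ≤ ·) := toAntisymmetrization (· ≤ ·)
  let h : A → ℚ := fun x => e (toLinearExtension (q x))
  have hle : ∀ x y, ForcedLe x y → h x ≤ h y := fun x y hxy =>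
    e.monotone (toLinearExtension.monotone (toAntisymmetrization_mono hxy))
  have heq : ∀ x y, h x = h y → ForcedLe x y ∧ ForcedLe y x := fun x y hxy =>
    Quotient.exact (e.injective hxy : q x = q y)
  refine ⟨⟨h, fun f => (nomatch f), fun R x hx => ?_⟩⟩
  cases R with
  | ne =>
    rw [show x = ![x 0, x 1] from List.ofFn_inj.1 rfl] at hx
    exact fun hxy => hne _ _ (heq _ _ hxy).1 (heq _ _ hxy).2 hx
  | sll =>
    rw [show x = ![x 0, x 1, x 2, x 3] from List.ofFn_inj.1 rfl] at hx
    by_cases hxy : h (x 0) = h (x 1)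
    · exact Or.inr (hle _ _ (ForcedLe.sll (heq _ _ hxy).1 (heq _ _ hxy).2 hx))
    · exact Or.inl hxy

end

theorem cspExpressibleInDatalog_neSllLang : CSPExpressibleInDatalog neSllLang ℚ := by
  refine ⟨forcedEqSentence, fun A _ _ => ?_⟩
  rw [holds_forcedEqSentence_iff]
  constructor
  · rintro ⟨a, b, ⟨hab, hba⟩, hne⟩ ⟨h⟩
    exact h.map_rel _ _ hne (le_antisymm (hab.map_le h) (hba.map_le h))
  · contrapose!
    exact fun h => nonempty_hom_of_forall_not_forced fun a b hab hba hne => h a b ⟨hab, hba⟩ hne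

/-! ### Simulations between structures preserve Datalog -/

section
variable {L : FirstOrder.Language.{0, 0}}

/-- A strategy of Duplicator in the existential pebble game from `A` to `B`, as a relation between
tuples of `A` and tuples of `B` of the same length: it is closed under selecting entries, maps
equal entries to equal entries and related tuples to related tuples, and answers each new
element of `A` as long as the tuples have fewer than `K` entries. -/
structure PebbleStrategy (L : FirstOrder.Language.{0, 0}) (A B : Type) [L.Structure A]
    [L.Structure B] (K : ℕ) where
  rel : ∀ {n : ℕ}, (Fin n → A) → (Fin n → B) → Prop
  select : ∀ {n m : ℕ} {v : Fin n → A} {w : Fin n → B} {v' : Fin m → A} {w' : Fin m → B}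
    (σ : Fin m → Fin n), (∀ i, v' i = v (σ i)) → (∀ i, w' i = w (σ i)) → rel v w → rel v' w'
  map_eq : ∀ {n : ℕ} {v : Fin n → A} {w : Fin n → B}, rel v w → ∀ i j, v i = v j → w i = w j
  map_rel : ∀ {n : ℕ} {v : Fin n → A} {w : Fin n → B}, rel v w → ∀ R : L.Relations n,
    FirstOrder.Language.Structure.RelMap R v → FirstOrder.Language.Structure.RelMap R w
  extend : ∀ {n : ℕ} {v : Fin n → A} {w : Fin n → B}, n < K → rel v w →
    ∀ a : A, ∃ b : B, rel (Fin.snoc v a : Fin (n + 1) → A) (Fin.snoc w b : Fin (n + 1) → B)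

/-- The number of pebbles needed to evaluate the quantifiers of a formula. The bound variables
of a least fixed point do not require pebbles to be placed anew: their values arise by selection
from the tuples that are pebbled already. -/
def DatalogFormula.pebbles : {Γ : List ℕ} → {n : ℕ} → DatalogFormula L Γ n → ℕ
  | _, _, .falsum => 0
  | _, _, .eq _ _ => 0
  | _, _, .rel _ _ => 0
  | _, _, .var _ _ => 0
  | _, _, .and φ ψ => max φ.pebbles ψ.pebbles
  | _, _, .or φ ψ => max φ.pebbles ψ.pebbles
  | _, n, .ex φ => max (n + 1) φ.pebbles
  | _, _, .lfp φ _ => φ.pebbles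

variable {A B : Type} [L.Structure A] [L.Structure B] {K : ℕ}

/-- The values of the relation variables in `A` are mapped to those in `B` by the strategy, when
the tuples `v` and `w` are pebbled. -/
def PebbleStrategy.EnvRel (H : PebbleStrategy L A B K) {Γ : List ℕ} {n : ℕ} (ρ : RelEnv Γ A)
    (ρ' : RelEnv Γ B) (v : Fin n → A) (w : Fin n → B) : Prop :=
  ∀ (k : ℕ) (X : RelVar Γ k) (s : Fin k → A) (s' : Fin k → B),
    H.rel (Fin.append v s) (Fin.append w s') → s ∈ ρ k X → s' ∈ ρ' k X

theorem PebbleStrategy.EnvRel.of_select {H : PebbleStrategy L A B K} {Γ : List ℕ} {n m : ℕ}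
    {ρ : RelEnv Γ A} {ρ' : RelEnv Γ B} {v : Fin n → A} {w : Fin n → B} {v' : Fin m → A}
    {w' : Fin m → B} (hρ : H.EnvRel ρ ρ' v w) (σ : Fin n → Fin m) (hv : ∀ i, v i = v' (σ i))
    (hw : ∀ i, w i = w' (σ i)) : H.EnvRel ρ ρ' v' w' := by
  refine fun k X s s' hs => hρ k X s s' (H.select
    (Fin.append (fun i => Fin.castAdd k (σ i)) (Fin.natAdd m)) ?_ ?_ hs) <;>
  · intro i
    refine Fin.addCases (fun i => ?_) (fun i => ?_) i <;> simp [hv, hw]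

/-- Truth of a Datalog formula is preserved by every strategy with enough pebbles. -/
theorem PebbleStrategy.realize (H : PebbleStrategy L A B K) {Γ : List ℕ} {n : ℕ}
    (φ : DatalogFormula L Γ n) (hφ : φ.pebbles ≤ K) {ρ : RelEnv Γ A} {ρ' : RelEnv Γ B}
    {v : Fin n → A} {w : Fin n → B} (hvw : H.rel v w) (hρ : H.EnvRel ρ ρ' v w)
    (h : φ.Realize ρ v) : φ.Realize ρ' w := by
  induction φ with
  | falsum => exact h
  | eq i j => exact H.map_eq hvw i j h
  | rel R t => exact H.map_rel (H.select t (fun _ => rfl) (fun _ => rfl) hvw) R h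
  | @var _ n k X t =>
    refine hρ k X _ _ (H.select (Fin.append id t) ?_ ?_ hvw) h <;>
    · intro i
      refine Fin.addCases (fun i => ?_) (fun i => ?_) i <;> simp
  | and φ ψ ihφ ihψ =>
    exact ⟨ihφ (le_of_max_le_left hφ) hvw hρ h.1, ihψ (le_of_max_le_right hφ) hvw hρ h.2⟩
  | or φ ψ ihφ ihψ =>
    exact h.imp (ihφ (le_of_max_le_left hφ) hvw hρ) (ihψ (le_of_max_le_right hφ) hvw hρ)
  | ex φ ih =>
    obtain ⟨a, ha⟩ := h
    obtain ⟨b, hb⟩ := H.extend (le_of_max_le_left hφ) hvw a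
    exact ⟨b, ih (le_of_max_le_right hφ) hb
      (hρ.of_select Fin.castSucc (fun i => by simp) fun i => by simp) ha⟩
  | @lfp _ n k φ t ih =>
    intro S' hS'
    -- The pull-back of a pre-fixed point `S'` in `B` is a pre-fixed point in `A`.
    have hmem := h {s | ∀ s', H.rel (Fin.append v s) (Fin.append w s') → s' ∈ S'} ?_
    · refine hmem _ (H.select (Fin.append id t) ?_ ?_ hvw) <;>
      · intro i
        refine Fin.addCases (fun i => ?_) (fun i => ?_) i <;> simp
    · intro x hx s' hs'
      refine hS' (ih hφ hs' ?_ hx)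
      intro l X s s'' hs
      cases X with
      | zero =>
        refine fun hmem => hmem s'' (H.select
          (Fin.append (fun i => Fin.castAdd _ (Fin.castAdd _ i)) (Fin.natAdd _)) ?_ ?_ hs) <;>
        · intro i
          refine Fin.addCases (fun i => ?_) (fun i => ?_) i <;> simp
      | succ X =>
        exact hρ.of_select (v' := Fin.append v x) (w' := Fin.append w s') (Fin.castAdd _)
          (fun i => by simp) (fun i => by simp) l X s s'' hs

/-! ### A true Datalog sentence is true in a finite substructure -/

/-- A homomorphism is a strategy for any number of pebbles. -/
def PebbleStrategy.ofHom (f : A →[L] B) (K : ℕ) : PebbleStrategy L A B K where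
  rel v w := ∀ i, w i = f (v i)
  select σ hv hw h i := by rw [hw, hv, h]
  map_eq h i j hij := by rw [h, h, hij]
  map_rel {n v w} h R hR := by
    rw [show w = f ∘ v from funext h]
    exact f.map_rel R v hR
  extend {n v w} _ h a := ⟨f a, fun i => by
    refine Fin.lastCases ?_ (fun i => ?_) i <;> simp [h]⟩

theorem PebbleStrategy.envRel_ofHom (f : A →[L] B) (K : ℕ) {Γ : List ℕ} {n : ℕ} {ρ : RelEnv Γ A}
    {ρ' : RelEnv Γ B} {v : Fin n → A} {w : Fin n → B}
    (h : ∀ k (X : RelVar Γ k) (s : Fin k → A), s ∈ ρ k X → (fun i => f (s i)) ∈ ρ' k X) :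
    (PebbleStrategy.ofHom f K).EnvRel ρ ρ' v w := by
  intro k X s s' hs hmem
  rw [show s' = fun i => f (s i) from funext fun i => by simpa using hs (Fin.natAdd n i)]
  exact h k X s hmem

theorem DatalogFormula.Realize.mono {Γ : List ℕ} {n : ℕ} {φ : DatalogFormula L Γ n}
    {ρ ρ' : RelEnv Γ A} {v : Fin n → A} (h : φ.Realize ρ v) (hρ : ∀ k X, ρ k X ⊆ ρ' k X) :
    φ.Realize ρ' v :=
  (PebbleStrategy.ofHom (FirstOrder.Language.Hom.id L A) φ.pebbles).realize φ le_rfl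
    (fun _ => rfl) (PebbleStrategy.envRel_ofHom _ _ fun k X _ hs => hρ k X hs) h

/-- The relation defined by a least fixed point. -/
def DatalogFormula.lfpSet {Γ : List ℕ} {n k : ℕ} (φ : DatalogFormula L (k :: Γ) (n + k))
    (ρ : RelEnv Γ A) (v : Fin n → A) : Set (Fin k → A) :=
  sInf {S : Set (Fin k → A) | {x | φ.Realize (ρ.cons S) (Fin.append v x)} ⊆ S}

theorem DatalogFormula.mem_lfpSet_of_realize {Γ : List ℕ} {n k : ℕ}
    {φ : DatalogFormula L (k :: Γ) (n + k)} {ρ : RelEnv Γ A} {v : Fin n → A} {x : Fin k → A}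
    (h : φ.Realize (ρ.cons (φ.lfpSet ρ v)) (Fin.append v x)) : x ∈ φ.lfpSet ρ v := by
  refine fun S hS => hS (h.mono fun l X => ?_)
  cases X with
  | zero => exact sInf_le hS
  | succ X => exact subset_rfl

/-- The structure that a set of elements inherits, for a relational signature. -/
abbrev inducedStructure [L.IsRelational] (F : Set B) : L.Structure F where
  funMap f := isEmptyElim f
  RelMap R x := FirstOrder.Language.Structure.RelMap R fun i => (x i : B)

attribute [local instance] inducedStructure

/-- The inclusion of a set of elements. -/
def inducedHom [L.IsRelational] (F : Set B) : F →[L] B where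
  toFun := Subtype.val
  map_fun' f := isEmptyElim f
  map_rel' _ _ h := h

/-- The inclusion between two sets of elements. -/
def inclusionHom [L.IsRelational] {F G : Set B} (h : F ⊆ G) : F →[L] G where
  toFun := Set.inclusion h
  map_fun' f := isEmptyElim f
  map_rel' _ _ h := h

/-- The restriction of the values of the relation variables to a set of elements. -/
def RelEnv.restrict {Γ : List ℕ} (ρ : RelEnv Γ B) (F : Set B) : RelEnv Γ F :=
  fun k X => {s | (fun i => (s i : B)) ∈ ρ k X}

/-- Truth of a Datalog formula has a finite witness: a finite set such that the formula is true in
the structure induced on any larger set. The witness has to work for all larger sets at once for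
the induction to pass through least fixed points. -/
theorem DatalogFormula.Realize.exists_finite [L.IsRelational] {Γ : List ℕ} {n : ℕ}
    {φ : DatalogFormula L Γ n} {ρ : RelEnv Γ B} {v : Fin n → B} (h : φ.Realize ρ v) :
    ∃ F₀ : Set B, F₀.Finite ∧ ∀ F : Set B, F₀ ⊆ F → ∀ v' : Fin n → F, (∀ i, (v' i : B) = v i) →
      φ.Realize (ρ.restrict F) v' := by
  induction φ with
  | falsum => exact h.elim
  | eq i j =>
    exact ⟨∅, Set.finite_empty, fun F _ v' hv => Subtype.ext ((hv i).trans (h.trans (hv j).symm))⟩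
  | rel R t =>
    refine ⟨∅, Set.finite_empty, fun F _ v' hv => ?_⟩
    obtain rfl : (fun i => (v' i : B)) = v := funext hv
    exact h
  | var X t =>
    refine ⟨∅, Set.finite_empty, fun F _ v' hv => ?_⟩
    obtain rfl : (fun i => (v' i : B)) = v := funext hv
    exact h
  | and φ ψ ihφ ihψ =>
    obtain ⟨F₁, hF₁, h₁⟩ := ihφ h.1
    obtain ⟨F₂, hF₂, h₂⟩ := ihψ h.2
    exact ⟨F₁ ∪ F₂, hF₁.union hF₂, fun F hF v' hv => ⟨h₁ F (Set.union_subset_iff.1 hF).1 v' hv,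
      h₂ F (Set.union_subset_iff.1 hF).2 v' hv⟩⟩
  | or φ ψ ihφ ihψ =>
    rcases h with h | h
    · obtain ⟨F₁, hF₁, h₁⟩ := ihφ h
      exact ⟨F₁, hF₁, fun F hF v' hv => Or.inl (h₁ F hF v' hv)⟩
    · obtain ⟨F₁, hF₁, h₁⟩ := ihψ h
      exact ⟨F₁, hF₁, fun F hF v' hv => Or.inr (h₁ F hF v' hv)⟩
  | ex φ ih =>
    obtain ⟨a, ha⟩ := h
    obtain ⟨F₁, hF₁, h₁⟩ := ih ha
    refine ⟨insert a F₁, hF₁.insert a, fun F hF v' hv => ⟨⟨a, hF (Set.mem_insert a F₁)⟩,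
      h₁ F ((Set.subset_insert a F₁).trans hF) _ fun i => ?_⟩⟩
    refine Fin.lastCases ?_ (fun i => ?_) i <;> simp [hv]
  | @lfp Γ n k φ t ih =>
    -- It suffices that the tuples that enter the least fixed point in all sufficiently large
    -- sets of elements form a pre-fixed point in `B`.
    let S : Set (Fin k → B) := {x | ∃ F₀ : Set B, F₀.Finite ∧ ∀ F : Set B, F₀ ⊆ F →
      ∀ (v' : Fin n → F) (x' : Fin k → F), (∀ i, (v' i : B) = v i) → (∀ i, (x' i : B) = x i) →
        x' ∈ φ.lfpSet (ρ.restrict F) v'}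
    have hS : {x | φ.Realize (ρ.cons S) (Fin.append v x)} ⊆ S := by
      intro x hx
      obtain ⟨F₁, hF₁, h₁⟩ := ih hx
      let F₂ : Set B := F₁ ∪ (Set.range v ∪ Set.range x)
      have hF₂ : F₂.Finite := hF₁.union ((Set.finite_range v).union (Set.finite_range x))
      have := hF₂.to_subtype
      let v₂ : Fin n → F₂ := fun i => ⟨v i, Or.inr (Or.inl ⟨i, rfl⟩)⟩
      let x₂ : Fin k → F₂ := fun i => ⟨x i, Or.inr (Or.inr ⟨i, rfl⟩)⟩
      have h₂ := h₁ F₂ Set.subset_union_left (Fin.append v₂ x₂) fun i => by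
        refine Fin.addCases (fun i => ?_) (fun i => ?_) i <;> simp [v₂, x₂]
      -- Only finitely many tuples over `F₂` matter, each with its own finite witness.
      choose! W hWfin hW using fun (s : Fin k → F₂) (hs : (fun i => (s i : B)) ∈ S) => hs
      refine ⟨F₂ ∪ ⋃ s ∈ {s : Fin k → F₂ | (fun i => (s i : B)) ∈ S}, W s,
        hF₂.union (Set.Finite.biUnion (Set.toFinite _) hWfin), fun F hF v' x' hv hx' => ?_⟩
      have hF₂F : F₂ ⊆ F := Set.subset_union_left.trans hF
      apply DatalogFormula.mem_lfpSet_of_realize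
      refine (PebbleStrategy.ofHom (inclusionHom (L := L) hF₂F) φ.pebbles).realize φ le_rfl
        (v := Fin.append v₂ x₂) ?_ (PebbleStrategy.envRel_ofHom _ _ fun l X s hs => ?_) h₂
      · intro i
        refine Subtype.ext ?_
        refine Fin.addCases (fun i => ?_) (fun i => ?_) i
        · simp only [Fin.append_left]
          exact hv i
        · simp only [Fin.append_right]
          exact hx' i
      · cases X with
        | zero =>
          refine hW s hs F (fun b hb => hF (Or.inr ?_)) v' _ hv fun i => rfl
          exact Set.mem_biUnion (s := {s : Fin k → F₂ | (fun i => (s i : B)) ∈ S}) hs hb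
        | succ X => exact hs
    obtain ⟨F₀, hF₀, h₀⟩ := h S hS
    exact ⟨F₀, hF₀, fun F hF v' hv => h₀ F hF v' (fun i => v' (t i)) hv fun i => hv (t i)⟩

/-- If `CSP(B)` is expressible in Datalog, by the sentence `φ`, then `φ` is false in `B` itself,
although `B` may be infinite. -/
theorem not_holds_self [L.IsRelational] {φ : DatalogSentence L}
    (hφ : ∀ (A : Type) [Finite A] [L.Structure A], φ.Holds A ↔ ¬ Nonempty (A →[L] B)) :
    ¬ φ.Holds B := by
  intro h
  obtain ⟨F, hF, hreal⟩ := DatalogFormula.Realize.exists_finite h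
  have := hF.to_subtype
  refine (hφ F).1 ?_ ⟨inducedHom F⟩
  exact (hreal F subset_rfl Fin.elim0 fun i => i.elim0).mono fun k X => nomatch X

end

/-- Duplicator strategies for all numbers of pebbles, from finite structures without a
homomorphism to `B`, show that `CSP(B)` is not expressible in Datalog. -/
theorem not_cspExpressibleInDatalog_of_strategies {L : FirstOrder.Language.{0, 0}}
    [L.IsRelational] {B : Type} [L.Structure B]
    (h : ∀ K : ℕ, ∃ (A : Type) (_ : Finite A) (_ : L.Structure A) (H : PebbleStrategy L A B K),
      ¬ Nonempty (A →[L] B) ∧ H.rel Fin.elim0 Fin.elim0) : ¬ CSPExpressibleInDatalog L B := by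
  rintro ⟨φ, hφ⟩
  obtain ⟨A, _, _, H, hA, h0⟩ := h (DatalogFormula.pebbles φ)
  exact not_holds_self hφ (H.realize φ le_rfl h0 (fun k X => nomatch X) ((hφ A).2 hA))

/-! ### Pebble strategies on instances of `R_min` with large boundaries -/

/-- The `R_min`-structure with the constraints `x > min (f x) (g x)` for all `x`. -/
abbrev rminInstance {V : Type} (f g : V → V) : rminLang.Structure V where
  funMap f := nomatch f
  RelMap {_} R := match R with
    | RminRel.rmin => fun v => f (v 0) = v 1 ∧ g (v 0) = v 2

/-- An instance in which every element has a constraint has no solution: consider an element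
with the least value. -/
theorem isEmpty_hom_rminInstance {V : Type} [Finite V] [Nonempty V] (f g : V → V) :
    letI := rminInstance f g
    ¬ Nonempty (V →[rminLang] ℚ) := by
  let _ := rminInstance f g
  rintro ⟨h⟩
  obtain ⟨x, hx⟩ := Finite.exists_min fun x => h x
  have := h.map_rel (n := 3) RminRel.rmin ![x, f x, g x] ⟨rfl, rfl⟩
  exact this.elim (hx (f x)).not_gt (hx (g x)).not_gt

section
variable {V : Type} [DecidableEq V]

/-- The out-boundary of `U` in the digraph with the arcs from `x` to `f x` and `g x`. -/
def bdry (f g : V → V) (U : Finset V) : Finset V :=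
  (U.image f ∪ U.image g) \ U

theorem mem_bdry {f g : V → V} {U : Finset V} {y : V} :
    y ∈ bdry f g U ↔ (∃ x ∈ U, f x = y ∨ g x = y) ∧ y ∉ U := by
  simp only [bdry, Finset.mem_sdiff, Finset.mem_union, Finset.mem_image, ← exists_or, and_or_left]

theorem bdry_union_subset {f g : V → V} {U U' : Finset V} :
    bdry f g (U ∪ U') ⊆ (bdry f g U \ U') ∪ (bdry f g U' \ U) := by
  intro y hy
  simp only [mem_bdry, Finset.mem_union, Finset.mem_sdiff] at hy ⊢
  obtain ⟨⟨x, hx | hx, hxy⟩, hyU⟩ := hy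
  · exact Or.inl ⟨⟨⟨x, hx, hxy⟩, fun h => hyU (Or.inl h)⟩, fun h => hyU (Or.inr h)⟩
  · exact Or.inr ⟨⟨⟨x, hx, hxy⟩, fun h => hyU (Or.inr h)⟩, fun h => hyU (Or.inl h)⟩

/-- An assignment `w` of the pebbled elements `v` is good if it satisfies the constraints
`x > min (bdry U)` with `x ∈ U`, for all `U` with at most `m` elements whose boundary is pebbled.
These follow from the constraints inside `U`. -/
def Good (f g : V → V) (m : ℕ) {n : ℕ} (v : Fin n → V) (w : Fin n → ℚ) : Prop :=
  (∀ i j, v i = v j → w i = w j) ∧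
    ∀ (U : Finset V) (i : Fin n), U.card ≤ m → v i ∈ U → (∀ y ∈ bdry f g U, ∃ j, v j = y) →
      ∃ j, v j ∈ bdry f g U ∧ w j < w i

/-- If sets of at most `2 * m` elements have large boundaries, then good assignments of fewer than
`K` elements extend to any further element `a`. The value of `a` has to lie above some and below
other values of `w`. If a lower bound from a set `U` and an upper bound from a set `U'` were in
conflict, then `U ∪ U'` would violate the goodness of `w`; its size is at most `m`, and not only
at most `2 * m`, as its boundary is pebbled and so has fewer than `K` elements. -/
theorem Good.extend [Finite V] {f g : V → V} {m K : ℕ} (hK : K ^ 2 ≤ m)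
    (hexp : ∀ U : Finset V, U.card ≤ 2 * m → U.card ≤ (bdry f g U).card ^ 2)
    {n : ℕ} {v : Fin n → V} {w : Fin n → ℚ} (hn : n < K) (h : Good f g m v w) (a : V) :
    ∃ b : ℚ, Good f g m (Fin.snoc v a : Fin (n + 1) → V) (Fin.snoc w b : Fin (n + 1) → ℚ) := by
  classical
  by_cases ha : ∃ i, v i = a
  · -- An element that is pebbled already keeps its value.
    obtain ⟨i₀, rfl⟩ := ha
    refine ⟨w i₀, ?_, ?_⟩
    · intro i j
      refine Fin.lastCases ?_ (fun i => ?_) i <;> refine Fin.lastCases ?_ (fun j => ?_) j <;>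
        simp only [Fin.snoc_last, Fin.snoc_castSucc] <;> first | exact h.1 _ _ | simp
    · intro U i hU hi hb
      have hb' : ∀ y ∈ bdry f g U, ∃ j, v j = y := by
        intro y hy
        obtain ⟨j, hj⟩ := hb y hy
        induction j using Fin.lastCases with
        | last => exact ⟨i₀, by simpa using hj⟩
        | cast j => exact ⟨j, by simpa using hj⟩
      have : ∃ j, v j ∈ bdry f g U ∧
          w j < (Fin.snoc w (w i₀) : Fin (n + 1) → ℚ) i := by
        induction i using Fin.lastCases with
        | last => simpa using h.2 U i₀ hU (by simpa using hi) hb'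
        | cast i => simpa using h.2 U i hU (by simpa using hi) hb'
      obtain ⟨j, hj⟩ := this
      exact ⟨j.castSucc, by simpa using hj⟩
  push Not at ha
  -- Lower bounds: the least values on the boundaries of the sets that contain `a`.
  let lo : Finset (Fin n) := Finset.univ.filter fun j => ∃ U : Finset V, U.card ≤ m ∧ a ∈ U ∧
    (∀ y ∈ bdry f g U, ∃ j, v j = y) ∧ v j ∈ bdry f g U ∧ ∀ j', v j' ∈ bdry f g U → w j ≤ w j'
  -- Upper bounds: the values on a set with `a` in its boundary that only `a` can witness.
  let hi : Finset (Fin n) := Finset.univ.filter fun i => ∃ U : Finset V, U.card ≤ m ∧ v i ∈ U ∧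
    a ∈ bdry f g U ∧ (∀ y ∈ bdry f g U, y = a ∨ ∃ j, v j = y) ∧
      ∀ j, v j ∈ bdry f g U → w i ≤ w j
  obtain ⟨b, hlo, hhi⟩ := Order.exists_between_finsets (lo.image w) (hi.image w) (by
    simp only [Finset.mem_image, forall_exists_index, and_imp, lo, hi, Finset.mem_filter,
      Finset.mem_univ, true_and]
    rintro _ j U hU haU hbU hjU hmin rfl _ i U' hU' hiU' haU' hbU' hmax rfl
    by_contra hij
    have hsub : ∀ y ∈ bdry f g (U ∪ U'), ∃ l, v l = y ∧ w i ≤ w l := by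
      intro y hy
      rcases Finset.mem_union.1 (bdry_union_subset hy) with hy | hy <;> rw [Finset.mem_sdiff] at hy
      · obtain ⟨l, rfl⟩ := hbU y hy.1
        exact ⟨l, rfl, (not_lt.1 hij).trans (hmin l hy.1)⟩
      · rcases hbU' y hy.1 with rfl | ⟨l, rfl⟩
        · exact absurd haU hy.2
        · exact ⟨l, rfl, hmax l hy.1⟩
    have hcard : (bdry f g (U ∪ U')).card ≤ n := by
      calc (bdry f g (U ∪ U')).card ≤ (Finset.univ.image v).card :=
            Finset.card_le_card fun y hy => by
              obtain ⟨l, rfl, _⟩ := hsub y hy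
              simp
        _ ≤ n := Finset.card_image_le.trans (by simp)
    have hUU : (U ∪ U').card ≤ m :=
      (hexp _ ((Finset.card_union_le U U').trans (by omega))).trans
        ((Nat.pow_le_pow_left (hcard.trans hn.le) 2).trans hK)
    obtain ⟨l, hl, hlt⟩ := h.2 _ i hUU (Finset.mem_union_right _ hiU') fun y hy =>
      (hsub y hy).imp fun _ => And.left
    obtain ⟨l', hl', hle⟩ := hsub _ hl
    rw [h.1 _ _ hl'] at hle
    exact hlt.not_ge hle)
  have hlo' : ∀ j ∈ lo, w j < b := fun j hj => hlo _ (Finset.mem_image_of_mem w hj)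
  have hhi' : ∀ j ∈ hi, b < w j := fun j hj => hhi _ (Finset.mem_image_of_mem w hj)
  simp only [lo, hi, Finset.mem_filter, Finset.mem_univ, true_and] at hlo' hhi'
  refine ⟨b, ?_, ?_⟩
  · intro i j
    refine Fin.lastCases ?_ (fun i => ?_) i <;> refine Fin.lastCases ?_ (fun j => ?_) j <;>
      simp only [Fin.snoc_last, Fin.snoc_castSucc]
    · simp
    · exact fun hj => absurd hj.symm (ha j)
    · exact fun hi => absurd hi (ha i)
    · exact h.1 i j
  · intro U i hU hiU hbU
    have hbU' : ∀ y ∈ bdry f g U, y = a ∨ ∃ j, v j = y := by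
      intro y hy
      obtain ⟨j, hj⟩ := hbU y hy
      induction j using Fin.lastCases with
      | last => exact Or.inl (by simpa using hj.symm)
      | cast j => exact Or.inr ⟨j, by simpa using hj⟩
    by_cases haU : a ∈ bdry f g U
    · induction i using Fin.lastCases with
      | last =>
        simp only [Fin.snoc_last] at hiU
        exact absurd hiU (mem_bdry.1 haU).2
      | cast i =>
        simp only [Fin.snoc_castSucc] at hiU ⊢
        by_cases hex : ∃ j, v j ∈ bdry f g U ∧ w j < w i
        · obtain ⟨j, hj⟩ := hex
          exact ⟨j.castSucc, by simpa using hj⟩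
        · push Not at hex
          exact ⟨Fin.last n, by simpa using ⟨haU, hhi' i ⟨U, hU, hiU, haU, hbU', hex⟩⟩⟩
    · have hbU'' : ∀ y ∈ bdry f g U, ∃ j, v j = y := fun y hy =>
        (hbU' y hy).resolve_left fun hya => haU (hya ▸ hy)
      suffices ∃ j, v j ∈ bdry f g U ∧ w j < (Fin.snoc w b : Fin (n + 1) → ℚ) i by
        obtain ⟨j, hj⟩ := this
        exact ⟨j.castSucc, by simpa using hj⟩
      induction i using Fin.lastCases with
      | last =>
        simp only [Fin.snoc_last] at hiU ⊢
        have hne : (bdry f g U).Nonempty := by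
          have := hexp U (by omega)
          rw [← Finset.card_pos]
          have hpos := Finset.card_pos.2 ⟨a, hiU⟩
          by_contra h0
          simp only [not_lt, nonpos_iff_eq_zero] at h0
          rw [h0] at this
          omega
        obtain ⟨y, hy⟩ := hne
        obtain ⟨j₀, rfl⟩ := hbU'' y hy
        obtain ⟨j, hj, hmin⟩ := Finset.exists_min_image
          (Finset.univ.filter fun j => v j ∈ bdry f g U) w ⟨j₀, by simpa using hy⟩
        simp only [Finset.mem_filter, Finset.mem_univ, true_and] at hj hmin
        exact ⟨j, hj, hlo' j ⟨U, hU, hiU, hbU'', hj, hmin⟩⟩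
      | cast i =>
        simp only [Fin.snoc_castSucc] at hiU ⊢
        exact h.2 U i hU hiU hbU''

/-- The good assignments are a strategy of Duplicator. -/
def goodStrategy [Finite V] {f g : V → V} {m K : ℕ} (hm : 1 ≤ m) (hK : K ^ 2 ≤ m)
    (hexp : ∀ U : Finset V, U.card ≤ 2 * m → U.card ≤ (bdry f g U).card ^ 2) :
    letI := rminInstance f g
    PebbleStrategy rminLang V ℚ K :=
  letI := rminInstance f g
  { rel := Good f g m
    select := by
      intro n k v w v' w' σ hv hw h
      obtain rfl := funext hv
      obtain rfl := funext hw
      refine ⟨fun i j => h.1 _ _, fun U i hU hi hb => ?_⟩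
      obtain ⟨j, hj, hlt⟩ := h.2 U (σ i) hU hi fun y hy => by
        obtain ⟨j, hj⟩ := hb y hy
        exact ⟨σ j, hj⟩
      obtain ⟨j', hj'⟩ := hb _ hj
      exact ⟨j', hj' ▸ hj, (h.1 _ _ hj').trans_lt hlt⟩
    map_eq := fun h => h.1
    map_rel := by
      intro n v w h R hR
      cases R with
      | rmin =>
        obtain ⟨h1, h2⟩ := hR
        have hb : ∀ y ∈ bdry f g {v 0}, v 1 = y ∨ v 2 = y := by
          intro y hy
          simpa [mem_bdry, h1, h2] using (mem_bdry.1 hy).1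
        obtain ⟨j, hj, hlt⟩ := h.2 {v 0} 0 (by simpa using hm) (by simp) fun y hy =>
          (hb y hy).elim (fun h => ⟨1, h⟩) fun h => ⟨2, h⟩
        exact (hb _ hj).imp (fun h' => (h.1 _ _ h').trans_lt hlt)
          fun h' => (h.1 _ _ h').trans_lt hlt
    extend := fun hn h a => h.extend hK hexp hn a }

end

/-! ### Boundaries in the directed torus -/

section
variable {N : ℕ}

/-- The step in the first direction of the torus. -/
def stepRight (x : ZMod N × ZMod N) : ZMod N × ZMod N := (x.1 + 1, x.2)

/-- The step in the second direction of the torus. -/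
def stepUp (x : ZMod N × ZMod N) : ZMod N × ZMod N := (x.1, x.2 + 1)

/-- A set of residues closed under adding `1` is empty or everything. -/
theorem mem_of_forall_add_one_mem [NeZero N] {S : Set (ZMod N)} (hS : ∀ x ∈ S, x + 1 ∈ S)
    {x : ZMod N} (hx : x ∈ S) (y : ZMod N) : y ∈ S := by
  have key : ∀ n : ℕ, x + n ∈ S := by
    intro n
    induction n with
    | zero => simpa using hx
    | succ n ih => simpa [add_assoc] using hS _ ih
  simpa using key (y - x).val

/-- A row or column of a set with fewer than `N` elements has a boundary point, if it is not
empty, since it is not closed under the step in its direction. So the set is contained in a product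
of two projections of its boundary. -/
theorem card_le_card_bdry_sq [NeZero N] (U : Finset (ZMod N × ZMod N)) (hU : U.card < N) :
    U.card ≤ (bdry stepRight stepUp U).card ^ 2 := by
  have hline : ∀ e : ZMod N → ZMod N × ZMod N, Function.Injective e →
      ∀ x, e x ∈ U → ∃ y, e y ∈ U ∧ e (y + 1) ∉ U := by
    intro e he x hx
    by_contra! hcl
    have hall := mem_of_forall_add_one_mem (S := {y | e y ∈ U}) hcl hx
    have := Finset.card_le_card_of_injOn e (s := Finset.univ) (fun y _ => hall y) he.injOn
    rw [Finset.card_univ, ZMod.card] at this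
    omega
  have hsub : U ⊆ (bdry stepRight stepUp U).image Prod.fst ×ˢ
      (bdry stepRight stepUp U).image Prod.snd := by
    rintro ⟨i, j⟩ hij
    rw [Finset.mem_product, Finset.mem_image, Finset.mem_image]
    constructor
    · obtain ⟨y, hy, hy'⟩ := hline (fun y => (i, y)) (fun _ _ h => (Prod.ext_iff.1 h).2) j hij
      exact ⟨(i, y + 1), mem_bdry.2 ⟨⟨_, hy, Or.inr rfl⟩, hy'⟩, rfl⟩
    · obtain ⟨y, hy, hy'⟩ := hline (fun y => (y, j)) (fun _ _ h => (Prod.ext_iff.1 h).1) i hij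
      exact ⟨(y + 1, j), mem_bdry.2 ⟨⟨_, hy, Or.inl rfl⟩, hy'⟩, rfl⟩
  calc U.card ≤ _ := Finset.card_le_card hsub
    _ ≤ (bdry stepRight stepUp U).card * (bdry stepRight stepUp U).card := by
      rw [Finset.card_product]
      exact Nat.mul_le_mul Finset.card_image_le Finset.card_image_le
    _ = _ := (sq _).symm

end

theorem not_cspExpressibleInDatalog_rminLang : ¬ CSPExpressibleInDatalog rminLang ℚ := by
  refine not_cspExpressibleInDatalog_of_strategies fun K => ?_
  -- Sets of more than `m = (K + 1) ^ 2` elements have boundaries of more than `K` elements, and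
  -- the torus is too large for sets of at most `2 * m` elements to contain a row or column.
  let m := (K + 1) ^ 2
  let N := 2 * m + 1
  have hm : 1 ≤ m := Nat.one_le_pow _ _ K.succ_pos
  have hexp : ∀ U : Finset (ZMod N × ZMod N), U.card ≤ 2 * m →
      U.card ≤ (bdry stepRight stepUp U).card ^ 2 :=
    fun U hU => card_le_card_bdry_sq U (Nat.lt_succ_of_le hU)
  exact ⟨ZMod N × ZMod N, inferInstance, rminInstance stepRight stepUp,
    goodStrategy hm (Nat.pow_le_pow_left K.le_succ 2) hexp, isEmpty_hom_rminInstance _ _,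
    fun i => i.elim0, fun _ i => i.elim0⟩

/-! ### Conditions on clones -/

/-- A condition that is preserved by uniformly continuous clone homomorphisms and captures
Datalog would pass from `(ℚ; ≠, S_ll)` to `(ℚ; R_min)`. -/
theorem not_capturesDatalogForTemporalCSPs {E : CloneCondition} (hE : PreservedByUCCloneHoms E) :
    ¬ CapturesDatalogForTemporalCSPs E := fun h =>
  not_cspExpressibleInDatalog_rminLang <| (h rminLang isTemporal_rminLang).2 <|
    hE _ _ _ _ minEssentialHom minEssentialHom_uniformlyContinuous <|
      (h neSllLang isTemporal_neSllLang).1 cspExpressibleInDatalog_neSllLang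

end TemporalCSP

theorem mainTheorem5 :
    (∀ E : TemporalCSP.CloneCondition, TemporalCSP.PreservedByUCCloneHoms E →
      ¬ TemporalCSP.CapturesDatalogForTemporalCSPs E) ∧
    TemporalCSP.IsTemporal TemporalCSP.neSllLang ∧
    TemporalCSP.IsTemporal TemporalCSP.rminLang ∧
    TemporalCSP.CSPExpressibleInDatalog TemporalCSP.neSllLang ℚ ∧
    ¬ TemporalCSP.CSPExpressibleInDatalog TemporalCSP.rminLang ℚ ∧
    ∃ ξ : TemporalCSP.CloneHom (TemporalCSP.Pol TemporalCSP.neSllLang ℚ)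
        (TemporalCSP.Pol TemporalCSP.rminLang ℚ),
      ξ.UniformlyContinuous :=
  ⟨fun _ hE => TemporalCSP.not_capturesDatalogForTemporalCSPs hE,
    TemporalCSP.isTemporal_neSllLang, TemporalCSP.isTemporal_rminLang,
    TemporalCSP.cspExpressibleInDatalog_neSllLang,
    TemporalCSP.not_cspExpressibleInDatalog_rminLang,
    TemporalCSP.minEssentialHom, TemporalCSP.minEssentialHom_uniformlyContinuous⟩
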